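/- Let $G \le \mathrm{GL}(n,\mathbb{R})$ be a matrix Lie group, i.e. a closed subgroup of $\mathrm{GL}(n,\mathbb{R})$ with matrix multiplication as group product. Let $\mathfrak{g} = T_e G \subseteq \mathbb{R}^{n\times n}$ be its Lie algebra, that is, the space of velocities $\dot\gamma(0)$ of smooth curves $\gamma$ in $G$ with $\gamma(0)=I$. Let $d = \dim \mathfrak{g}$, and for $g\in G$ let $\mathrm{Ad}_g:\mathfrak{g}\to\mathfrak{g}$, $\mathrm{Ad}_g(X) = gXg^{-1}$, be the adjoint action. Fix a basis of $\mathfrak{g}$, let $\mathcal{L}[\mathrm{Ad}_g]\in \mathrm{GL}(d,\mathbb{R})$ be the matrix of $\mathrm{Ad}_g$ in this basis, and put $$\mathcal{L}[\mathrm{Ad}_G] := \{\mathcal{L}[\mathrm{Ad}_g] \mid g\in G\}.$$ If $G$ is compact, then $\mathcal{L}[\mathrm{Ad}_G]$ is a compact, hence closed, subgroup of $\mathrm{GL}(d,\mathbb{R})$. Consequently, $\mathcal{L}[\mathrm{Ad}_G]$ is an embedded matrix Lie subgroup of $\mathrm{GL}(d,\mathbb{R})$: with the subspace topology it carries the structure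 of a finite-dimensional smooth manifold for which it is a Lie group and its inclusion into $\mathrm{GL}(d,\mathbb{R})$ is a smooth embedding. -/

import Mathlib

open scoped Manifold ContDiff Matrix MatrixGroups Matrix.Norms.Operator

noncomputable section

namespace MatrixLie

/-- The Lie algebra `𝔤 = T_e G` of a group `G` of invertible real matrices: the velocities at
`t = 0` of the smooth curves of matrices that run in `G` and pass through the identity at
`t = 0`. -/
def lieAlgebra {n : ℕ} (G : Subgroup (GL (Fin n) ℝ)) :
    Submodule ℝ (Matrix (Fin n) (Fin n) ℝ) where
  carrier := {X | ∃ γ : ℝ → GL (Fin n) ℝ, (∀ t, γ t ∈ G) ∧ γ 0 = 1 ∧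
    ContDiff ℝ ∞ (fun t => (γ t : Matrix (Fin n) (Fin n) ℝ)) ∧
    HasDerivAt (fun t => (γ t : Matrix (Fin n) (Fin n) ℝ)) X 0}
  add_mem' := by
    rintro X Y ⟨γ, hG, h0, hs, hd⟩ ⟨δ, kG, k0, ks, kd⟩
    refine ⟨fun t => γ t * δ t, fun t => G.mul_mem (hG t) (kG t), by simp [h0, k0], ?_, ?_⟩
    · simpa using hs.mul ks
    · have h := HasDerivAt.mul hd kd
      simp only [h0, k0, Units.val_one, mul_one, one_mul] at h
      exact h
  zero_mem' := ⟨fun _ => 1, fun _ => G.one_mem, rfl, contDiff_const, hasDerivAt_const _ _⟩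
  smul_mem' := by
    rintro c X ⟨γ, hG, h0, hs, hd⟩
    refine ⟨fun t => γ (c * t), fun t => hG _, by simp [h0], ?_, ?_⟩
    · exact hs.comp (contDiff_const.mul contDiff_id)
    · have h1 : HasDerivAt (fun t : ℝ => c * t) c 0 := by
        simpa using (hasDerivAt_id (0 : ℝ)).const_mul c
      have h2 : HasDerivAt (fun t => (γ t : Matrix (Fin n) (Fin n) ℝ)) X (c * 0) := by
        simpa using hd
      exact h2.scomp (0 : ℝ) h1

theorem conj_mem_lieAlgebra {n : ℕ} {G : Subgroup (GL (Fin n) ℝ)} {g : GL (Fin n) ℝ}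
    (hg : g ∈ G) {X : Matrix (Fin n) (Fin n) ℝ} (hX : X ∈ lieAlgebra G) :
    (g : Matrix (Fin n) (Fin n) ℝ) * X * (g⁻¹ : GL (Fin n) ℝ) ∈ lieAlgebra G := by
  obtain ⟨γ, hG, h0, hs, hd⟩ := hX
  refine ⟨fun t => g * γ t * g⁻¹, fun t => G.mul_mem (G.mul_mem hg (hG t)) (G.inv_mem hg),
    by simp [h0], ?_, ?_⟩
  · simpa only [Units.val_mul] using (contDiff_const.mul hs).mul contDiff_const
  · exact (HasDerivAt.const_mul _ hd).mul_const _

/-- The adjoint action `Ad_g : 𝔤 → 𝔤`, `Ad_g X = g X g⁻¹`, of an element `g` of `G`. -/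
def Ad {n : ℕ} (G : Subgroup (GL (Fin n) ℝ)) (g : G) : lieAlgebra G →ₗ[ℝ] lieAlgebra G where
  toFun X := ⟨(g : GL (Fin n) ℝ) * (X : Matrix (Fin n) (Fin n) ℝ) *
    ((g : GL (Fin n) ℝ)⁻¹ : GL (Fin n) ℝ), conj_mem_lieAlgebra g.2 X.2⟩
  map_add' X Y := by ext1; simp only [Submodule.coe_add, mul_add, add_mul]
  map_smul' c X := by
    ext1; simp only [Submodule.coe_smul, mul_smul_comm, smul_mul_assoc, RingHom.id_apply]

theorem Ad_comp_Ad_eq_id {n : ℕ} (G : Subgroup (GL (Fin n) ℝ)) {g h : G} (hgh : g * h = 1) :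
    Ad G g ∘ₗ Ad G h = LinearMap.id := by
  obtain rfl : h = g⁻¹ := (inv_eq_of_mul_eq_one_right hgh).symm
  ext1 X
  ext1
  simp [Ad, mul_assoc]

/-- The matrix `L[Ad_g] ∈ GL(d, ℝ)` of the adjoint action of `g` in the basis `b` of `𝔤`. -/
def adMatrix {n d : ℕ} (G : Subgroup (GL (Fin n) ℝ)) (b : Module.Basis (Fin d) ℝ (lieAlgebra G))
    (g : G) : GL (Fin d) ℝ where
  val := LinearMap.toMatrix b b (Ad G g)
  inv := LinearMap.toMatrix b b (Ad G g⁻¹)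
  val_inv := by
    rw [← LinearMap.toMatrix_comp b b b, Ad_comp_Ad_eq_id G (mul_inv_cancel g),
      LinearMap.toMatrix_id]
  inv_val := by
    rw [← LinearMap.toMatrix_comp b b b, Ad_comp_Ad_eq_id G (inv_mul_cancel g),
      LinearMap.toMatrix_id]

/-- The adjoint image `L[Ad_G] = {L[Ad_g] | g ∈ G}`, as a set of invertible matrices. -/
def adjointImage {n d : ℕ} (G : Subgroup (GL (Fin n) ℝ))
    (b : Module.Basis (Fin d) ℝ (lieAlgebra G)) : Set (GL (Fin d) ℝ) :=
  {A | ∃ g : G, A = adMatrix G b g}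

/-- The smooth structure of `GL(d, ℝ)` as an open subset of the space of matrices: Mathlib's
structure on the units of a complete normed ring. (The instance is not found by itself because
the topology of entrywise convergence on matrices and the topology of the operator norm are equal
only after unfolding.) -/
instance instChartedSpaceGL (d : ℕ) :
    @ChartedSpace (Matrix (Fin d) (Fin d) ℝ) PseudoMetricSpace.toUniformSpace.toTopologicalSpace
      (GL (Fin d) ℝ) _ :=
  @Units.instChartedSpace (Matrix (Fin d) (Fin d) ℝ) _ _

instance instLieGroupGL (d : ℕ) :
    LieGroup 𝓘(ℝ, Matrix (Fin d) (Fin d) ℝ) ∞ (GL (Fin d) ℝ) :=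
  @Units.instLieGroupModelWithCornersSelf (Matrix (Fin d) (Fin d) ℝ) _ _ ∞ ℝ _ _

/-- A subgroup `H` of a Lie group `K` is an embedded Lie subgroup if, with the topology induced
from `K`, it carries a structure of a smooth manifold of some finite dimension `k` that makes it a
Lie group and its inclusion into `K` a smooth embedding. -/
def IsEmbeddedLieSubgroup {E M K : Type*} [NormedAddCommGroup E] [NormedSpace ℝ E]
    [TopologicalSpace M] (I : ModelWithCorners ℝ E M) [Group K] [TopologicalSpace K]
    [ChartedSpace M K] [LieGroup I ∞ K] (H : Subgroup K) : Prop :=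
  ∃ (k : ℕ) (_ : ChartedSpace (EuclideanSpace ℝ (Fin k)) H),
    LieGroup (𝓡 k) ∞ H ∧ Manifold.IsSmoothEmbedding (𝓡 k) I ∞ (Subtype.val : H → K)

end MatrixLie

end

/-! The adjoint image is the range of the continuous homomorphism `adMatrixHom` on a compact group,
hence compact, hence closed in a Hausdorff group. The rest is Cartan's closed subgroup theorem,
`isEmbeddedLieSubgroup_of_isClosed`. For closed `H`, the generators of one-parameter groups in `H`
form a linear space `V`, because limits of rescaled logarithms of elements of `H` lie in it
(`expUnit_smul_mem_of_tendsto`). The same fact and compactness of the unit sphere show that `exp y ∉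
H` for small nonzero `y` in a complement `W` of `V`. Hence in the coordinates `exp v * exp w` with
`v ∈ V`, `w ∈ W`, the group `H` is `w = 0` near `1` (`exists_slice_at_one`). Left translation gives
such a chart at every point of `H`, and these charts yield the manifold structure and the embedding.
-/

noncomputable section

namespace MatrixLie

open Filter Topology NormedSpace

/-! ### One-parameter groups and logarithmic coordinates -/

section ExponentialOfClosedSubgroup

variable {A : Type*} [NormedRing A] [NormedAlgebra ℝ A] [CompleteSpace A]

/-- The exponential of a Banach algebra, with values in the group of units. -/
def expUnit (X : A) : Aˣ :=
  letI : NormedAlgebra ℚ A := .restrictScalars ℚ ℝ A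
  { val := exp X
    inv := exp (-X)
    val_inv := by rw [← exp_add_of_commute (Commute.refl X).neg_right]; simp
    inv_val := by rw [← exp_add_of_commute (Commute.refl X).neg_left]; simp }

@[simp]
theorem val_expUnit (X : A) : (expUnit X : A) = exp X := rfl

theorem continuous_expUnit : Continuous (expUnit : A → Aˣ) := by
  let : NormedAlgebra ℚ A := .restrictScalars ℚ ℝ A
  exact Units.continuous_iff.2 ⟨exp_continuous, exp_continuous.comp continuous_neg⟩

theorem expUnit_zero : expUnit (0 : A) = 1 := Units.ext exp_zero

theorem expUnit_neg (X : A) : expUnit (-X) = (expUnit X)⁻¹ :=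
  (inv_eq_of_mul_eq_one_right (Units.ext (expUnit X).val_inv)).symm

theorem expUnit_nsmul (m : ℕ) (X : A) : expUnit (m • X) = expUnit X ^ m := by
  let : NormedAlgebra ℚ A := .restrictScalars ℚ ℝ A
  exact Units.ext (exp_nsmul m X)

theorem expUnit_zsmul (m : ℤ) (X : A) : expUnit (m • X) = expUnit X ^ m := by
  obtain ⟨k, rfl | rfl⟩ := m.eq_nat_or_neg
  · rw [natCast_zsmul, expUnit_nsmul, zpow_natCast]
  · simp only [neg_smul, natCast_zsmul, expUnit_neg, expUnit_nsmul, zpow_neg, zpow_natCast]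

/-- A limit of rescaled logarithms of elements of a closed subgroup generates a one-parameter
group in that subgroup. -/
theorem expUnit_smul_mem_of_tendsto {H : Subgroup Aˣ} (hH : IsClosed (H : Set Aˣ)) {ι : Type*}
    {l : Filter ι} [l.NeBot] {s : ι → ℝ} {X : ι → A} {Y : A} (hs : Tendsto s l (𝓝 0))
    (hs0 : ∀ᶠ i in l, s i ≠ 0) (hX : Tendsto (fun i => (s i)⁻¹ • X i) l (𝓝 Y))
    (hmem : ∀ᶠ i in l, expUnit (X i) ∈ H) (t : ℝ) : expUnit (t • Y) ∈ H := by
  -- Rounding to an integer multiple of `s i` costs at most `|s i|`, and integer powers of `expUnit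
  -- (X i)` stay in `H`.
  have hm : Tendsto (fun i => (⌊t / s i⌋ : ℝ) * s i) l (𝓝 t) := by
    rw [tendsto_iff_norm_sub_tendsto_zero]
    refine squeeze_zero' (Eventually.of_forall fun _ => norm_nonneg _) ?_
      (by simpa using hs.norm : Tendsto (fun i => ‖s i‖) l (𝓝 0))
    filter_upwards [hs0] with i hi
    have h : (⌊t / s i⌋ : ℝ) * s i - t = -(Int.fract (t / s i) * s i) := by
      rw [Int.fract, sub_mul, div_mul_cancel₀ _ hi]
      ring
    rw [h, norm_neg, norm_mul, Real.norm_of_nonneg (Int.fract_nonneg _)]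
    exact mul_le_of_le_one_left (norm_nonneg _) (Int.fract_lt_one _).le
  refine hH.mem_of_tendsto ((continuous_expUnit.tendsto _).comp (hm.smul hX)) ?_
  filter_upwards [hs0, hmem] with i hi hHi
  have h : ((⌊t / s i⌋ : ℝ) * s i) • (s i)⁻¹ • X i = ⌊t / s i⌋ • X i := by
    rw [smul_smul, mul_assoc, mul_inv_cancel₀ hi, mul_one, Int.cast_smul_eq_zsmul]
  simp only [Function.comp_apply, h, expUnit_zsmul]
  exact H.zpow_mem hHi _

/-- The generators of the one-parameter groups in a closed subgroup of the units of a Banach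
algebra. -/
def oneParameterAlgebra (H : Subgroup Aˣ) (hH : IsClosed (H : Set Aˣ)) : Submodule ℝ A where
  carrier := {X | ∀ t : ℝ, expUnit (t • X) ∈ H}
  zero_mem' t := by simp [expUnit_zero, H.one_mem]
  smul_mem' c X hX t := by simpa [smul_smul] using hX (t * c)
  add_mem' := by
    intro X Y hX hY
    have hexp : HasStrictFDerivAt (exp : A → A) ((.refl ℝ A : A ≃L[ℝ] A) : A →L[ℝ] A) 0 :=
      hasStrictFDerivAt_exp_zero
    -- `L` is the logarithm near `1`. The curve `L (exp (t • X) * exp (t • Y))` has velocity `X + Y`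
    -- at `0`, so its rescalings by `t⁻¹` tend to `X + Y`.
    set L := hexp.localInverse
    have hprod : HasDerivAt (fun t : ℝ => exp (t • X) * exp (t • Y)) (X + Y) 0 := by
      have h := (hasDerivAt_exp_smul_const X (0 : ℝ)).mul (hasDerivAt_exp_smul_const Y (0 : ℝ))
      simpa [Pi.mul_def] using h
    have hL1 : HasFDerivAt L (ContinuousLinearMap.id ℝ A)
        (exp ((0 : ℝ) • X) * exp ((0 : ℝ) • Y)) := by
      simpa using hexp.to_localInverse.hasFDerivAt
    have hZ : HasDerivAt (fun t : ℝ => L (exp (t • X) * exp (t • Y))) (X + Y) 0 := by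
      simpa [Function.comp_def] using hL1.comp_hasDerivAt (0 : ℝ) hprod
    have hL0 : L 1 = 0 := by simpa using hexp.localInverse_apply_image
    refine expUnit_smul_mem_of_tendsto hH (l := 𝓝[≠] (0 : ℝ)) (s := id)
      (X := fun t : ℝ => L (exp (t • X) * exp (t • Y))) (tendsto_id.mono_left nhdsWithin_le_nhds)
      self_mem_nhdsWithin ?_ ?_
    · simpa [hL0] using hZ.tendsto_slope_zero
    · have hr : ∀ᶠ y in 𝓝 (1 : A), exp (L y) = y := by
        simpa using hexp.eventually_right_inverse
      have hc : Tendsto (fun t : ℝ => exp (t • X) * exp (t • Y)) (𝓝[≠] 0) (𝓝 1) := by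
        simpa using hprod.continuousAt.tendsto.mono_left nhdsWithin_le_nhds
      filter_upwards [hc.eventually hr] with t ht
      have h : expUnit (L (exp (t • X) * exp (t • Y))) = expUnit (t • X) * expUnit (t • Y) :=
        Units.ext ht
      rw [h]
      exact H.mul_mem (hX t) (hY t)

theorem expUnit_mem_of_mem_oneParameterAlgebra {H : Subgroup Aˣ} {hH : IsClosed (H : Set Aˣ)}
    {X : A} (hX : X ∈ oneParameterAlgebra H hH) : expUnit X ∈ H := by
  simpa using hX 1

/-- Near `0`, the exponential meets a closed subgroup only at `0` along a complement of its
algebra; the complement is given as the fixed space of `Q`. -/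
theorem eventually_expUnit_mem_imp_eq_zero [FiniteDimensional ℝ A] {H : Subgroup Aˣ}
    (hH : IsClosed (H : Set Aˣ)) (Q : A →L[ℝ] A)
    (hQ : ∀ y ∈ oneParameterAlgebra H hH, Q y = y → y = 0) :
    ∀ᶠ y in 𝓝 (0 : A), Q y = y → expUnit y ∈ H → y = 0 := by
  by_contra hcon
  set B : Set A := {y | Q y = y ∧ expUnit y ∈ H ∧ y ≠ 0} with hB
  have hfreq : ∃ᶠ y in 𝓝 (0 : A), y ∈ B := by
    refine (not_eventually.1 hcon).mono fun y hy => ?_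
    simpa [hB] using hy
  have : (𝓝 (0 : A) ⊓ 𝓟 B).NeBot := frequently_mem_iff_neBot.1 hfreq
  -- Along an ultrafilter the normalised vectors converge on the compact sphere without passing to a
  -- subsequence.
  set U : Ultrafilter A := Ultrafilter.of (𝓝 (0 : A) ⊓ 𝓟 B)
  have hU : (U : Filter A) ≤ 𝓝 (0 : A) ⊓ 𝓟 B := Ultrafilter.of_le _
  have hU0 : (U : Filter A) ≤ 𝓝 (0 : A) := hU.trans inf_le_left
  have hUB : ∀ᶠ y in (U : Filter A), y ∈ B := hU.trans inf_le_right (mem_principal_self B)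
  have : ProperSpace A := FiniteDimensional.proper ℝ A
  obtain ⟨u, hu, hlim⟩ := (isCompact_sphere (0 : A) 1).ultrafilter_le_nhds
    (U.map fun y => ‖y‖⁻¹ • y) (by
      rw [le_principal_iff, Ultrafilter.coe_map, mem_map]
      filter_upwards [hUB] with y hy
      simp [norm_smul, inv_mul_cancel₀ (norm_ne_zero_iff.2 hy.2.2)])
  have hlim' : Tendsto (fun y : A => ‖y‖⁻¹ • y) U (𝓝 u) := hlim
  have hmem : u ∈ oneParameterAlgebra H hH := by
    refine expUnit_smul_mem_of_tendsto hH (s := fun y : A => ‖y‖) (X := id) ?_ ?_ hlim' ?_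
    · simpa using (tendsto_id.mono_left hU0).norm
    · exact hUB.mono fun y hy => norm_ne_zero_iff.2 hy.2.2
    · exact hUB.mono fun y hy => hy.2.1
  have hfix : Q u = u := by
    refine tendsto_nhds_unique_of_eventuallyEq ((Q.continuous.tendsto u).comp hlim') hlim' ?_
    filter_upwards [hUB] with y hy
    simp [hy.1]
  have : u ≠ 0 := fun h => by simp [h] at hu
  exact this (hQ u hmem hfix)

/-- A splitting `Z = P Z + Q Z` gives the coordinates `Z ↦ exp (P Z) * exp (Q Z)` near `1`. -/
def splitExp (P Q : A →L[ℝ] A) (Z : A) : Aˣ := expUnit (P Z) * expUnit (Q Z)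

theorem contDiff_exp : ContDiff ℝ ω (exp : A → A) :=
  contDiff_iff_contDiffAt.2 fun X => (exp_analytic (𝕂 := ℝ) X).contDiffAt

theorem contDiff_splitExp (P Q : A →L[ℝ] A) :
    ContDiff ℝ ω (fun Z => (splitExp P Q Z : A)) :=
  (contDiff_exp.comp P.contDiff).mul (contDiff_exp.comp Q.contDiff)

/-- Each factor is `1` at `0`, so the derivative is `P + Q`, the identity; the inverse function
theorem then applies. -/
theorem hasFDerivAt_splitExp {P Q : A →L[ℝ] A} (hPQ : ∀ Z, P Z + Q Z = Z) :
    HasFDerivAt (fun Z => (splitExp P Q Z : A)) ((.refl ℝ A : A ≃L[ℝ] A) : A →L[ℝ] A) 0 := by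
  have hexp : ∀ R : A →L[ℝ] A, HasFDerivAt (fun Z => exp (R Z)) R 0 := fun R => by
    have h : HasFDerivAt (exp : A → A) (1 : A →L[ℝ] A) (R 0) := by
      simpa using hasFDerivAt_exp_zero (𝕂 := ℝ) (𝔸 := A)
    exact h.comp (0 : A) R.hasFDerivAt
  refine ((hexp P).mul' (hexp Q)).congr_fderiv ?_
  ext Z
  simpa [add_comm] using hPQ Z

/-- Logarithmic coordinates of a finite-dimensional algebra near `1` in which a closed subgroup of
the units is a linear subspace. -/
theorem exists_slice_at_one [FiniteDimensional ℝ A] {H : Subgroup Aˣ}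
    (hH : IsClosed (H : Set Aˣ)) {P Q : A →L[ℝ] A} (hPQ : ∀ Z, P Z + Q Z = Z)
    (hQQ : ∀ Z, Q (Q Z) = Q Z) (hP : ∀ Z, P Z ∈ oneParameterAlgebra H hH)
    (hQ : ∀ y ∈ oneParameterAlgebra H hH, Q y = y → y = 0) :
    ∃ ψ : OpenPartialHomeomorph A A, (1 : A) ∈ ψ.source ∧ ContDiffOn ℝ ∞ ψ ψ.source ∧
      ContDiffOn ℝ ∞ ψ.symm ψ.target ∧
      ∀ x : Aˣ, (x : A) ∈ ψ.source → (x ∈ H ↔ Q (ψ x) = 0) := by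
  have hsm := (contDiff_splitExp P Q).contDiffAt (x := (0 : A))
  have h01 : (splitExp P Q 0 : A) = 1 := by simp [splitExp]
  set Φ := hsm.toOpenPartialHomeomorph _ (hasFDerivAt_splitExp hPQ) (by simp)
  have h1 : (1 : A) ∈ Φ.target := by
    rw [← h01]
    exact hsm.image_mem_toOpenPartialHomeomorph_target (hasFDerivAt_splitExp hPQ) (by simp)
  have hΦ1 : Φ.symm 1 = 0 := by
    rw [← h01]
    exact hsm.localInverse_apply_image (hasFDerivAt_splitExp hPQ) (by simp)
  have hsymm : ContDiffAt ℝ ω Φ.symm 1 := by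
    rw [← h01]
    exact hsm.to_localInverse (hasFDerivAt_splitExp hPQ) (by simp)
  have hgood : ∀ᶠ x in 𝓝 (1 : A), ContDiffAt ℝ ω Φ.symm x ∧
      (Q (Q (Φ.symm x)) = Q (Φ.symm x) → expUnit (Q (Φ.symm x)) ∈ H → Q (Φ.symm x) = 0) := by
    -- Analyticity at a point spreads to a neighbourhood, which `ContDiffAt` of order `∞` need not
    -- do; hence the order `ω` up to here.
    refine (hsymm.eventually (by simp)).and ?_
    have hc : Tendsto (fun x => Q (Φ.symm x)) (𝓝 1) (𝓝 0) := by
      have h := (Q.continuous.tendsto _).comp (Φ.symm.continuousAt h1).tendsto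
      simpa [hΦ1, Function.comp_def] using h
    exact hc.eventually (eventually_expUnit_mem_imp_eq_zero hH Q hQ)
  obtain ⟨W, hW, hWo, h1W⟩ := eventually_nhds_iff.1 hgood
  refine ⟨Φ.symm.restrOpen W hWo, ⟨h1, h1W⟩, ?_, ?_, ?_⟩
  · exact fun x hx => ((hW x hx.2).1.of_le (by simp)).contDiffWithinAt
  · exact ((contDiff_splitExp P Q).of_le (by simp)).contDiffOn
  · rintro x ⟨hxt, hxW⟩
    have hx : x = expUnit (P (Φ.symm x)) * expUnit (Q (Φ.symm x)) :=
      Units.ext (Φ.right_inv hxt).symm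
    -- The first factor lies in `H`, so `x ∈ H` exactly when `expUnit (Q (Φ.symm x))` does.
    have hPm := expUnit_mem_of_mem_oneParameterAlgebra (hP (Φ.symm x))
    change x ∈ H ↔ Q (Φ.symm x) = 0
    refine ⟨fun hxH => (hW x hxW).2 (hQQ _) ?_, fun h0 => ?_⟩
    · rw [hx] at hxH
      exact (H.mul_mem_cancel_left hPm).1 hxH
    · rw [hx, h0, expUnit_zero, mul_one]
      exact hPm

end ExponentialOfClosedSubgroup

/-! ### Submanifolds from slice charts -/

section SliceCharts

variable {E F A N : Type*} [NormedAddCommGroup E] [NormedSpace ℝ E] [NormedAddCommGroup F]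
  [NormedSpace ℝ F] [NormedAddCommGroup A] [NormedSpace ℝ A] [TopologicalSpace N]

/-- A chart `ψ` is a slice chart of `S` if `S` corresponds in it to the first factor of the
decomposition `e : E × F ≃L[ℝ] A`. -/
def IsSliceChart (e : (E × F) ≃L[ℝ] A) (S : Set N) (ψ : OpenPartialHomeomorph N A) : Prop :=
  ∀ y ∈ ψ.source, y ∈ S ↔ (e.symm (ψ y)).2 = 0

variable {e : (E × F) ≃L[ℝ] A} {S : Set N} {ψ : OpenPartialHomeomorph N A}

theorem IsSliceChart.symm_mem (h : IsSliceChart e S ψ) {u : E} (hu : e (u, 0) ∈ ψ.target) :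
    ψ.symm (e (u, 0)) ∈ S := by
  rw [h _ (ψ.map_target hu), ψ.right_inv hu]
  simp

theorem IsSliceChart.apply_eq (h : IsSliceChart e S ψ) {y : N} (hy : y ∈ ψ.source) (hyS : y ∈ S) :
    e ((e.symm (ψ y)).1, 0) = ψ y := by
  rw [← (h y hy).1 hyS, Prod.mk.eta, e.apply_symm_apply]

open Classical in
/-- The chart of `S` with values in `E` that a slice chart induces. -/
def IsSliceChart.restrict (h : IsSliceChart e S ψ) (x : S) : OpenPartialHomeomorph S E where
  toFun y := (e.symm (ψ y)).1
  -- The point `x` only serves as a value outside the target.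
  invFun u := if hu : e (u, 0) ∈ ψ.target then ⟨ψ.symm (e (u, 0)), h.symm_mem hu⟩ else x
  source := Subtype.val ⁻¹' ψ.source
  target := {u | e (u, 0) ∈ ψ.target}
  map_source' y hy := by
    change e ((e.symm (ψ y)).1, 0) ∈ ψ.target
    rw [h.apply_eq hy y.2]
    exact ψ.map_source hy
  map_target' u hu := by
    have hu' : e (u, 0) ∈ ψ.target := hu
    simp [hu', ψ.map_target hu']
  left_inv' y hy := by
    have hy' : e ((e.symm (ψ y)).1, 0) ∈ ψ.target := by
      rw [h.apply_eq hy y.2]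
      exact ψ.map_source hy
    rw [dif_pos hy']
    ext
    change ψ.symm (e ((e.symm (ψ y)).1, 0)) = y
    rw [h.apply_eq hy y.2, ψ.left_inv hy]
  right_inv' u hu := by
    have hu' : e (u, 0) ∈ ψ.target := hu
    simp [hu', ψ.right_inv hu']
  open_source := ψ.open_source.preimage continuous_subtype_val
  open_target := ψ.open_target.preimage (by fun_prop)
  continuousOn_toFun := by
    have h1 : ContinuousOn (fun y : S => ψ y) (Subtype.val ⁻¹' ψ.source) :=
      ψ.continuousOn.comp continuous_subtype_val.continuousOn fun _ hy => hy
    exact (continuous_fst.comp e.symm.continuous).comp_continuousOn h1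
  continuousOn_invFun := by
    rw [IsEmbedding.subtypeVal.continuousOn_iff]
    have h1 : ContinuousOn (fun u : E => ψ.symm (e (u, 0))) {u | e (u, 0) ∈ ψ.target} :=
      ψ.continuousOn_symm.comp (by fun_prop) fun _ hu => hu
    refine h1.congr fun u hu => ?_
    have hu' : e (u, 0) ∈ ψ.target := hu
    simp [hu']

theorem IsSliceChart.mem_restrict_target (h : IsSliceChart e S ψ) (x : S) (u : E) :
    u ∈ (h.restrict x).target ↔ e (u, 0) ∈ ψ.target := Iff.rfl

theorem IsSliceChart.val_restrict_symm (h : IsSliceChart e S ψ) (x : S) {u : E}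
    (hu : e (u, 0) ∈ ψ.target) : ((h.restrict x).symm u : N) = ψ.symm (e (u, 0)) := by
  have hsymm : (h.restrict x).symm u = ⟨ψ.symm (e (u, 0)), h.symm_mem hu⟩ := dif_pos hu
  rw [hsymm]

variable [ChartedSpace A N]

/-- A subset with slice charts around each of its points is an embedded submanifold. -/
theorem exists_isSmoothEmbedding_of_isSliceChart
    (hS : ∀ x : S, ∃ ψ ∈ IsManifold.maximalAtlas 𝓘(ℝ, A) ∞ N, (x : N) ∈ ψ.source ∧
      IsSliceChart e S ψ) :
    ∃ _ : ChartedSpace E S, IsManifold 𝓘(ℝ, E) ∞ S ∧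
      Manifold.IsSmoothEmbedding 𝓘(ℝ, E) 𝓘(ℝ, A) ∞ (Subtype.val : S → N) := by
  choose ψ hψ hx hs using hS
  let C : ChartedSpace E S :=
    { atlas := Set.range fun x => (hs x).restrict x
      chartAt := fun x => (hs x).restrict x
      mem_chart_source := hx
      chart_mem_atlas := fun x => ⟨x, rfl⟩ }
  have hM : IsManifold 𝓘(ℝ, E) ∞ S := by
    refine isManifold_of_contDiffOn _ _ _ ?_
    rintro _ _ ⟨x, rfl⟩ ⟨y, rfl⟩
    -- A transition map of `S` is the ambient one between the inclusion of `E` and the projection to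
    -- `E`.
    have hsmooth : ContDiffOn ℝ ∞ (ψ y ∘ (ψ x).symm)
        ((ψ x).target ∩ (ψ x).symm ⁻¹' (ψ y).source) :=
      ((contMDiffOn_of_mem_maximalAtlas (hψ y)).comp
        ((contMDiffOn_symm_of_mem_maximalAtlas (hψ x)).mono Set.inter_subset_left)
        fun _ h => h.2).contDiffOn
    have hinc : ContDiff ℝ ∞ fun u : E => e (u, (0 : F)) :=
      e.contDiff.comp (contDiff_prodMk_left 0)
    have hproj : ContDiff ℝ ∞ fun a : A => (e.symm a).1 := contDiff_fst.comp e.symm.contDiff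
    refine (hproj.comp_contDiffOn (hsmooth.comp hinc.contDiffOn ?_)).congr ?_
      (s := 𝓘(ℝ, E).symm ⁻¹' (((hs x).restrict x).symm.trans ((hs y).restrict y)).source ∩
        Set.range 𝓘(ℝ, E))
    · rintro u ⟨⟨hu, hu'⟩, -⟩
      have hu : e (u, 0) ∈ (ψ x).target := hu
      refine ⟨hu, ?_⟩
      have h : ((((hs x).restrict x).symm u : S) : N) ∈ (ψ y).source := hu'
      rwa [(hs x).val_restrict_symm x hu] at h
    · rintro u ⟨⟨hu, hu'⟩, -⟩
      have hu : e (u, 0) ∈ (ψ x).target := hu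
      change (e.symm (ψ y (((hs x).restrict x).symm u : S))).1 = _
      rw [(hs x).val_restrict_symm x hu]
      rfl
  refine ⟨C, hM, ?_, IsEmbedding.subtypeVal⟩
  refine Manifold.IsImmersionOfComplement.isImmersion (F := F) fun x => ?_
  refine Manifold.IsImmersionAtOfComplement.mk_of_charts e ((hs x).restrict x) (ψ x) (hx x) (hx x)
    (IsManifold.chart_mem_maximalAtlas x) (hψ x) (fun _ h => h) ?_
  intro u hu
  have hu : e (u, 0) ∈ (ψ x).target := by simpa [IsSliceChart.mem_restrict_target] using hu
  change ψ x (((hs x).restrict x).symm u : S) = e (u, 0)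
  rw [(hs x).val_restrict_symm x hu, (ψ x).right_inv hu]

end SliceCharts

/-! ### The closed subgroup theorem -/

/-- Multiplication and inversion of a subgroup are smooth for any structure of a smooth manifold
that makes the inclusion a smooth embedding. -/
theorem lieGroup_of_isSmoothEmbedding {E A K : Type*} [NormedAddCommGroup E] [NormedSpace ℝ E]
    [NormedAddCommGroup A] [NormedSpace ℝ A] [Group K] [TopologicalSpace K] [ChartedSpace A K]
    [LieGroup 𝓘(ℝ, A) ∞ K] {H : Subgroup K} [ChartedSpace E H] [IsManifold 𝓘(ℝ, E) ∞ H]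
    (h : Manifold.IsSmoothEmbedding 𝓘(ℝ, E) 𝓘(ℝ, A) ∞ (Subtype.val : H → K)) :
    LieGroup 𝓘(ℝ, E) ∞ H := by
  have : IsTopologicalGroup K := topologicalGroup_of_lieGroup 𝓘(ℝ, A) ∞
  have hval := h.contMDiff
  -- A continuous map into an immersed manifold is smooth once its composite with the immersion is.
  exact
    { contMDiff_mul := (ContMDiff.iff_comp_isImmersion h.isImmersion).2
        ⟨continuous_mul, (hval.comp contMDiff_fst).mul (hval.comp contMDiff_snd)⟩
      contMDiff_inv := (ContMDiff.iff_comp_isImmersion h.isImmersion).2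
        ⟨continuous_inv, hval.inv⟩ }

/-- **Closed subgroup theorem**, for the units of a finite-dimensional real algebra. -/
theorem isEmbeddedLieSubgroup_of_isClosed {A : Type*} [NormedRing A] [NormedAlgebra ℝ A]
    [CompleteSpace A] [FiniteDimensional ℝ A] (H : Subgroup Aˣ) (hH : IsClosed (H : Set Aˣ)) :
    IsEmbeddedLieSubgroup 𝓘(ℝ, A) H := by
  set V := oneParameterAlgebra H hH
  obtain ⟨W, hVW⟩ := V.exists_isCompl
  let e : (EuclideanSpace ℝ (Fin (Module.finrank ℝ V)) × W) ≃L[ℝ] A :=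
    (((LinearEquiv.ofFinrankEq (EuclideanSpace ℝ (Fin (Module.finrank ℝ V))) V
      (by simp)).prodCongr (.refl ℝ W)).trans
        (Submodule.prodEquivOfIsCompl V W hVW)).toContinuousLinearEquiv
  have heV : ∀ u, e (u, 0) ∈ V := fun u => by simp [e]
  have heW : ∀ w, e (0, w) ∈ W := fun w => by simp [e]
  let P : A →L[ℝ] A := e.toContinuousLinearMap ∘L .inl ℝ _ W ∘L .fst ℝ _ W ∘L
    e.symm.toContinuousLinearMap
  let Q : A →L[ℝ] A := e.toContinuousLinearMap ∘L .inr ℝ _ W ∘L .snd ℝ _ W ∘L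
    e.symm.toContinuousLinearMap
  have hPdef : ∀ Z, P Z = e ((e.symm Z).1, 0) := fun Z => rfl
  have hQdef : ∀ Z, Q Z = e (0, (e.symm Z).2) := fun Z => rfl
  obtain ⟨ψ, h1, hψ, hψs, hψH⟩ := exists_slice_at_one hH (P := P) (Q := Q)
    (fun Z => by rw [hPdef, hQdef, ← map_add]; simp)
    (fun Z => by simp [hQdef])
    (fun Z => heV _)
    (fun y hy hQy => Submodule.disjoint_def.1 hVW.disjoint y hy (by rw [← hQy]; exact heW _))
  have hQ0 : ∀ Z, Q Z = 0 ↔ (e.symm Z).2 = 0 := fun Z => by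
    rw [hQdef, map_eq_zero_iff e e.injective]; simp
  have hslice : ∀ x : H, ∃ φ ∈ IsManifold.maximalAtlas 𝓘(ℝ, A) ∞ Aˣ, (x : Aˣ) ∈ φ.source ∧
      IsSliceChart e (H : Set Aˣ) φ := by
    intro x
    let c := chartAt A (1 : Aˣ)
    -- Translation by `x⁻¹` moves `x` to `1` and preserves `H`, so the slice at `1` becomes one at
    -- `x`.
    let m : Aˣ ≃ₜ Aˣ := Homeomorph.mulLeft (x : Aˣ)⁻¹
    have hc : ContMDiffOn 𝓘(ℝ, A) 𝓘(ℝ, A) ∞ c.symm c.target := contMDiffOn_chart_symm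
    refine ⟨m.toOpenPartialHomeomorph.trans (c.trans ψ), ?_, ?_, ?_⟩
    · refine OpenPartialHomeomorph.mem_maximalAtlas_of_contMDiffOn (I := 𝓘(ℝ, A)) (n := ∞) _ ?_ ?_
      · refine hψ.contMDiffOn.comp (t := ψ.source)
          ((Units.contMDiff_val.comp (contMDiff_mul_left (a := (x : Aˣ)⁻¹))).contMDiffOn) ?_
        exact fun y hy => hy.2.2
      · refine (contMDiff_mul_left (a := (x : Aˣ))).comp_contMDiffOn
          (hc.comp (hψs.contMDiffOn.mono ?_) ?_) |>.congr ?_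
        · exact fun z hz => hz.1.1
        · exact fun z hz => hz.1.2
        · intro z hz
          simp [m, Homeomorph.mulLeft_symm]
    · refine ⟨trivial, trivial, ?_⟩
      change (((x : Aˣ)⁻¹ * x : Aˣ) : A) ∈ ψ.source
      simpa using h1
    · intro y hy
      have hy' : (((x : Aˣ)⁻¹ * y : Aˣ) : A) ∈ ψ.source := hy.2.2
      exact (H.mul_mem_cancel_left (H.inv_mem x.2)).symm.trans ((hψH _ hy').trans (hQ0 _))
  obtain ⟨C, hM, hemb⟩ := exists_isSmoothEmbedding_of_isSliceChart hslice
  exact ⟨_, C, lieGroup_of_isSmoothEmbedding (H := H) hemb, hemb⟩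

/-! ### Continuity of the adjoint representation -/

section AdjointImage

variable {n d : ℕ} (G : Subgroup (GL (Fin n) ℝ)) (b : Module.Basis (Fin d) ℝ (lieAlgebra G))

/-- The adjoint representation in the basis `b`, as a group homomorphism. -/
def adMatrixHom : G →* GL (Fin d) ℝ where
  toFun := adMatrix G b
  map_one' := by
    ext1
    change LinearMap.toMatrix b b (Ad G 1) = 1
    rw [← LinearMap.toMatrix_id b]
    congr 1
    ext X
    simp [Ad]
  map_mul' g h := by
    ext1
    change LinearMap.toMatrix b b (Ad G (g * h)) =
      LinearMap.toMatrix b b (Ad G g) * LinearMap.toMatrix b b (Ad G h)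
    rw [← LinearMap.toMatrix_comp b b b]
    congr 1
    ext X
    simp [Ad, mul_assoc]

theorem continuous_toMatrix_Ad : Continuous fun g : G => LinearMap.toMatrix b b (Ad G g) := by
  refine continuous_matrix fun i j => ?_
  have hAd : Continuous fun g : G => Ad G g (b j) := by
    refine Continuous.subtype_mk ?_ _
    have hval : Continuous fun g : G => ((g : GL (Fin n) ℝ) : Matrix (Fin n) (Fin n) ℝ) :=
      Units.continuous_val.comp continuous_subtype_val
    have hinv : Continuous fun g : G =>
        (((g : GL (Fin n) ℝ)⁻¹ : GL (Fin n) ℝ) : Matrix (Fin n) (Fin n) ℝ) :=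
      Units.continuous_val.comp (continuous_inv.comp continuous_subtype_val)
    exact (hval.mul continuous_const).mul hinv
  simp only [LinearMap.toMatrix_apply]
  exact (LinearMap.continuous_of_finiteDimensional (b.coord i)).comp hAd

/-- The topology on units also demands continuity of the inverse matrix, which is by construction
the matrix of `Ad G g⁻¹`. -/
theorem continuous_adMatrixHom : Continuous (adMatrixHom G b) :=
  Units.continuous_iff.2 ⟨continuous_toMatrix_Ad G b,
    (continuous_toMatrix_Ad G b).comp continuous_inv⟩

end AdjointImage

end MatrixLie

end

theorem mainTheorem8 {n d : ℕ} (G : Subgroup (GL (Fin n) ℝ))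
    (hG : IsCompact (G : Set (GL (Fin n) ℝ)))
    (b : Module.Basis (Fin d) ℝ (MatrixLie.lieAlgebra G)) :
    ∃ H : Subgroup (GL (Fin d) ℝ),
      (H : Set (GL (Fin d) ℝ)) = MatrixLie.adjointImage G b ∧
      IsCompact (H : Set (GL (Fin d) ℝ)) ∧
      IsClosed (H : Set (GL (Fin d) ℝ)) ∧
      MatrixLie.IsEmbeddedLieSubgroup 𝓘(ℝ, Matrix (Fin d) (Fin d) ℝ) H := by
  have : CompactSpace G := isCompact_iff_compactSpace.1 hG
  have hcompact : IsCompact ((MatrixLie.adMatrixHom G b).range : Set (GL (Fin d) ℝ)) := by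
    rw [MonoidHom.coe_range]
    exact isCompact_range (MatrixLie.continuous_adMatrixHom G b)
  refine ⟨(MatrixLie.adMatrixHom G b).range, ?_, hcompact, hcompact.isClosed, ?_⟩
  · ext M
    exact ⟨fun ⟨g, hg⟩ => ⟨g, hg.symm⟩, fun ⟨g, hg⟩ => ⟨g, hg.symm⟩⟩
  · exact @MatrixLie.isEmbeddedLieSubgroup_of_isClosed (Matrix (Fin d) (Fin d) ℝ) _ _ _ _
      (MatrixLie.adMatrixHom G b).range hcompact.isClosed
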